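/- Let $L$ be a finite (non-empty) lattice that is graded of rank $n$, i.e. every maximal chain of $L$ has exactly $n+1$ elements. Then $L$ is supersolvable if and only if $L$ has an $S_n$ EL-labeling. Here: $\bullet$ $L$ is \emph{supersolvable} if it contains a maximal chain $M$ such that, for every chain $C$ of $L$, the sublattice of $L$ generated by $M\cup C$ is distributive. $\bullet$ Let $\mathcal{E}(L)=\{(s,t) : t \text{ covers } s \text{ in } L\}$. A function $\lambda:\mathcal{E}(L)\to\mathbb{Z}$ assigns to each maximal chain $\mathfrak{m}: s=s_0<s_1<\cdots<s_k=t$ of an interval $[s,t]$ the sequence $\lambda(\mathfrak{m})=(\lambda(s_0,s_1),\ldots,\lambda(s_{k-1},s_k))$, and $\mathfrak{m}$ is \emph{increasing} if this sequence is weakly increasing. The function $\lambda$ is an \emph{EL-labeling} if, for all $s\le t$ in $L$, the interval $[s,t]$ has exactly one increasing maximal chain $\mathfrak{m}$, and every other maximal chain $\mathfrak{m}'$ of $[s,t]$ satisfies $\lambda(\mathfrak{m}')>\lambda(\mathfrak{m})$ in lexicographic order. $\bullet$ An EL-labeling $\lambda$ is an \emph{$S_n$ EL-labeling} if, for every maximal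 chain $\hat 0=x_0<x_1<\cdots<x_n=\hat 1$ of $L$, the map $i\mapsto\lambda(x_{i-1},x_i)$ is a permutation of $[n]=\{1,\ldots,n\}$. -/

import Mathlib

namespace Snelling

/-- `P` is graded of rank `n`: every maximal chain of `P` has length `n`,
that is, has exactly `n + 1` elements. -/
def IsGradedOfRank (P : Type*) [PartialOrder P] (n : ℕ) : Prop :=
  ∀ c : Set P, IsMaxChain (· ≤ ·) c → c.ncard = n + 1

/-- The edges of the Hasse diagram of `P`: pairs `(s, t)` such that `t` covers `s`. -/
abbrev Edge (P : Type*) [PartialOrder P] : Type _ := {e : P × P // e.1 ⋖ e.2}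

/-- Saturated chains `s₀ ⋖ s₁ ⋖ ⋯ ⋖ s_k`. In a finite poset, the maximal chains of an interval
`[s, t]` are exactly the saturated chains with `s₀ = s` and `s_k = t`. -/
abbrev SaturatedChain (P : Type*) [PartialOrder P] : Type _ :=
  RelSeries {e : P × P | e.1 ⋖ e.2}

/-- `m` is a maximal chain of the interval `[s, t]`. -/
def IsMaxChainOf {P : Type*} [PartialOrder P] (m : SaturatedChain P) (s t : P) : Prop :=
  m.head = s ∧ m.last = t

/-- The labels `λ(s₀, s₁), …, λ(s_{k-1}, s_k)` along a saturated chain. -/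
def labels {P : Type*} [PartialOrder P] (lab : Edge P → ℤ) (m : SaturatedChain P) :
    Fin m.length → ℤ :=
  fun i => lab ⟨(m i.castSucc, m i.succ), m.step i⟩

/-- `m` is increasing: its labels weakly increase along the chain. -/
def IsIncreasing {P : Type*} [PartialOrder P] (lab : Edge P → ℤ) (m : SaturatedChain P) : Prop :=
  Monotone (labels lab m)

/-- An edge-labeling is an EL-labeling if every interval `[s, t]` has exactly one increasing
maximal chain, and every other maximal chain of `[s, t]` has a lexicographically larger label
sequence (`<` on lists is the lexicographic order). -/
def IsELLabeling {P : Type*} [PartialOrder P] (lab : Edge P → ℤ) : Prop :=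
  ∀ s t : P, s ≤ t → ∃ m : SaturatedChain P,
    IsMaxChainOf m s t ∧ IsIncreasing lab m ∧
    (∀ m' : SaturatedChain P, IsMaxChainOf m' s t → IsIncreasing lab m' → m' = m) ∧
    (∀ m' : SaturatedChain P, IsMaxChainOf m' s t → m' ≠ m →
      List.ofFn (labels lab m) < List.ofFn (labels lab m'))

/-- An `S_n` EL-labeling: an EL-labeling whose labels along every maximal chain of `P`
form a permutation of `{1, …, n}`. -/
def IsSnELLabeling {P : Type*} [PartialOrder P] [BoundedOrder P] (n : ℕ)
    (lab : Edge P → ℤ) : Prop :=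
  IsELLabeling lab ∧
    ∀ m : SaturatedChain P, IsMaxChainOf m ⊥ ⊤ →
      Set.BijOn (labels lab m) Set.univ (Set.Icc (1 : ℤ) n)

/-- `P` is `S_n` EL-shellable (snellable): it has an `S_n` EL-labeling. -/
def IsSnELShellable (P : Type*) [PartialOrder P] [BoundedOrder P] (n : ℕ) : Prop :=
  ∃ lab : Edge P → ℤ, IsSnELLabeling n lab

/-- The sublattice `S` is a distributive lattice. -/
def IsDistributive {L : Type*} [Lattice L] (S : Sublattice L) : Prop :=
  ∀ x y z : S, x ⊓ (y ⊔ z) = (x ⊓ y) ⊔ (x ⊓ z)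

/-- The sublattice of `L` generated by a set `s`. -/
def generated {L : Type*} [Lattice L] (s : Set L) : Sublattice L :=
  Sublattice.ofIsSublattice (latticeClosure s) isSublattice_latticeClosure

/-- `M` is an M-chain of `L`: a maximal chain which together with any chain generates a
distributive sublattice. -/
def IsMChain {L : Type*} [Lattice L] (M : Set L) : Prop :=
  IsMaxChain (· ≤ ·) M ∧
    ∀ c : Set L, IsChain (· ≤ ·) c → IsDistributive (generated (M ∪ c))

/-- `L` is supersolvable: it has an M-chain. -/
def IsSupersolvable (L : Type*) [Lattice L] : Prop :=
  ∃ M : Set L, IsMChain M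

end Snelling

/-!
Both directions attach to each element `x` of the lattice a set `S x` of labels such that `S` is
strictly increasing and `S y` exceeds `S x` by exactly one label, that of the edge, when `x ⋖ y`.

Given an `S_n` EL-labeling, `S x` is the set of labels on any saturated chain from `⊥` to `x`; it does
not depend on the chain, since a fixed chain from `x` to `⊤` carries the complementary labels. The
elements `m` of the increasing chain `M` from `⊥` to `⊤` are determined by their sets
`S m = {1, …, i}`. Cutting increasing chains at the label `i` gives `S (x ⊓ m) = S x ∩ S m` and
`S (x ⊔ m) = S x ∪ S m` for all `x` (`isSupersolvable_of_isSnELLabeling`). This is enough for `M` to be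
an M-chain (`isDistributive_generated_of_rankSet`): if `C` is a chain, then for `w ≤ c` in `L` the
inequality `w ⊔ (c ⊓ m) ≤ (w ⊔ m) ⊓ c` yields `S (w ⊔ (c ⊓ m)) = S w ∪ (S c ∩ S m)`, so `S` of a join of
elements `c ⊓ m` with `c ∈ C ∪ {⊤}` and `m ∈ M` is the union of the sets `S c ∩ S m`. Hence such joins
are closed under meets too, and `S` embeds the lattice they form into a lattice of sets.

Conversely, let `m 0 ⋖ ⋯ ⋖ m n` be an M-chain, label `x ⋖ y` by the least `i` with `y ≤ x ⊔ m i`, and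
let `S x` be the set of `i ≥ 1` with `m i ≤ x ⊔ m (i - 1)`. Distributivity of the sublattice generated
by the M-chain, `x` and `y` shows that the label of `x ⋖ y` is the only element of `S y \ S x`, so
labels on maximal chains of `[s, t]` are permutations of `S t \ S s`. If `i` is the least element of
that set, `s ⊔ (m i ⊓ t)` is the only cover of `s` in `[s, t]` reached by an edge labeled `i`
(`isSnELShellable_of_isMChain`). An increasing chain has to start there, chains that do not
start there are lexicographically larger, and induction on `s` finishes (`isSnELLabeling_of_step`).
-/

namespace Snelling

/-! ### Lattices with a set-valued rank function -/

section RankSets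

variable {L α : Type*} [Lattice L] {S : L → Set α} {M : Set L}

/-- If `w ≤ c`, then the join of `w` with `c ⊓ m` lies below `(w ⊔ m) ⊓ c`, so its set is no larger
than distributivity in `Set α` predicts. -/
theorem rankSet_sup_inf (hS : Monotone S) (hinf : ∀ x, ∀ m ∈ M, S x ∩ S m ⊆ S (x ⊓ m))
    (hsup : ∀ x, ∀ m ∈ M, S (x ⊔ m) ⊆ S x ∪ S m) {w c m : L} (hm : m ∈ M) (hw : w ≤ c) :
    S (w ⊔ c ⊓ m) = S w ∪ S c ∩ S m := by
  apply Set.Subset.antisymm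
  · have hle : w ⊔ c ⊓ m ≤ (w ⊔ m) ⊓ c :=
      sup_le (le_inf le_sup_left hw) (le_inf (inf_le_right.trans le_sup_right) inf_le_left)
    intro a ha
    have h1 := hsup w m hm (hS (hle.trans inf_le_left) ha)
    have h2 := hS (hle.trans inf_le_right) ha
    exact h1.imp id fun h => ⟨h2, h⟩
  · exact Set.union_subset (hS le_sup_left) ((hinf c m hm).trans (hS le_sup_right))

/-- The set of a join of elements `c ⊓ m` is the expected union. The joinands are added in the order
of their first components, so that `rankSet_sup_inf` applies to each of them. -/
theorem rankSet_finsetSup [OrderBot L] (hS : Monotone S) (hbot : S ⊥ = ∅)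
    (hinf : ∀ x, ∀ m ∈ M, S x ∩ S m ⊆ S (x ⊓ m))
    (hsup : ∀ x, ∀ m ∈ M, S (x ⊔ m) ⊆ S x ∪ S m) {c : Set L} (hc : IsChain (· ≤ ·) c)
    (P : Finset (L × L)) (hP : ∀ p ∈ P, p.1 ∈ c ∧ p.2 ∈ M) :
    S (P.sup fun p => p.1 ⊓ p.2) = ⋃ p ∈ P, S p.1 ∩ S p.2 := by
  classical
  induction hk : P.card generalizing P with
  | zero =>
    rw [Finset.card_eq_zero] at hk
    simp [hk, hbot]
  | succ k ih =>
    have hne : (P.image Prod.fst).Nonempty := by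
      rw [Finset.image_nonempty, ← Finset.card_pos]; omega
    obtain ⟨x, hx, hmax⟩ := (P.image Prod.fst).exists_maximal hne
    obtain ⟨p, hp, rfl⟩ := Finset.mem_image.1 hx
    have hle : ∀ q ∈ P, q.1 ≤ p.1 := fun q hq =>
      (hc.total (hP q hq).1 (hP p hp).1).elim id (hmax (Finset.mem_image_of_mem _ hq))
    have ih' := ih (P.erase p) (fun q hq => hP q (Finset.mem_of_mem_erase hq))
      (by rw [Finset.card_erase_of_mem hp, hk]; rfl)
    have hw : ((P.erase p).sup fun q => q.1 ⊓ q.2) ≤ p.1 :=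
      Finset.sup_le fun q hq => inf_le_left.trans (hle q (Finset.mem_of_mem_erase hq))
    have key := rankSet_sup_inf hS hinf hsup (hP p hp).2 hw
    rw [ih'] at key
    rw [← Finset.insert_erase hp, Finset.sup_insert, sup_comm, key, Finset.set_biUnion_insert,
      Set.union_comm]

/-- A strictly monotone set-valued map which is compatible with meets and joins with the members of
a chain `M` makes the sublattice generated by `M` and any other chain distributive.
That sublattice consists of joins of elements `c ⊓ m`, on which the map is an injective lattice
homomorphism into a lattice of sets. -/
theorem isDistributive_generated_of_rankSet [BoundedOrder L] (hS : StrictMono S) (hbot : S ⊥ = ∅)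
    (hM : IsChain (· ≤ ·) M) (htop : ⊤ ∈ M)
    (hinf : ∀ x, ∀ m ∈ M, S x ∩ S m ⊆ S (x ⊓ m))
    (hsup : ∀ x, ∀ m ∈ M, S (x ⊔ m) ⊆ S x ∪ S m) {c : Set L} (hc : IsChain (· ≤ ·) c) :
    IsDistributive (generated (M ∪ c)) := by
  classical
  have hmono := hS.monotone
  have hc' : IsChain (· ≤ ·) (insert ⊤ c) := hc.insert fun _ _ _ => Or.inr le_top
  have hchain_inf : ∀ {s : Set L}, IsChain (· ≤ ·) s → ∀ {x y}, x ∈ s → y ∈ s → x ⊓ y ∈ s := by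
    intro s hs x y hx hy
    rcases hs.total hx hy with h | h
    · rwa [inf_eq_left.2 h]
    · rwa [inf_eq_right.2 h]
  set f : L × L → L := fun p => p.1 ⊓ p.2
  set T : Set L := {x | ∃ P : Finset (L × L), (∀ p ∈ P, p.1 ∈ insert ⊤ c ∧ p.2 ∈ M) ∧ x = P.sup f}
  have hSf : ∀ {P : Finset (L × L)}, (∀ p ∈ P, p.1 ∈ insert ⊤ c ∧ p.2 ∈ M) →
      S (P.sup f) = ⋃ p ∈ P, S p.1 ∩ S p.2 := fun {P} hP =>
    rankSet_finsetSup hmono hbot hinf hsup hc' P hP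
  have hTsup : ∀ x ∈ T, ∀ y ∈ T, x ⊔ y ∈ T ∧ S (x ⊔ y) = S x ∪ S y := by
    rintro _ ⟨P, hP, rfl⟩ _ ⟨Q, hQ, rfl⟩
    have hPQ : ∀ p ∈ P ∪ Q, p.1 ∈ insert ⊤ c ∧ p.2 ∈ M := fun p hp =>
      (Finset.mem_union.1 hp).elim (hP p) (hQ p)
    refine ⟨⟨P ∪ Q, hPQ, Finset.sup_union.symm⟩, ?_⟩
    rw [← Finset.sup_union, hSf hPQ, hSf hP, hSf hQ, Finset.set_biUnion_union]
  have hTinf : ∀ x ∈ T, ∀ y ∈ T, x ⊓ y ∈ T ∧ S (x ⊓ y) = S x ∩ S y := by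
    rintro _ ⟨P, hP, rfl⟩ _ ⟨Q, hQ, rfl⟩
    -- the join of all meets of a joinand of `x` with a joinand of `y`
    set R : Finset (L × L) := (P ×ˢ Q).image fun r => (r.1.1 ⊓ r.2.1, r.1.2 ⊓ r.2.2)
    have hR : ∀ p ∈ R, p.1 ∈ insert ⊤ c ∧ p.2 ∈ M := by
      intro p hp
      obtain ⟨⟨a, b⟩, hab, rfl⟩ := Finset.mem_image.1 hp
      obtain ⟨ha, hb⟩ := Finset.mem_product.1 hab
      exact ⟨hchain_inf hc' (hP a ha).1 (hQ b hb).1, hchain_inf hM (hP a ha).2 (hQ b hb).2⟩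
    have hle : R.sup f ≤ P.sup f ⊓ Q.sup f := by
      refine Finset.sup_le fun p hp => ?_
      obtain ⟨⟨a, b⟩, hab, rfl⟩ := Finset.mem_image.1 hp
      obtain ⟨ha, hb⟩ := Finset.mem_product.1 hab
      exact le_inf ((inf_le_inf inf_le_left inf_le_left).trans (Finset.le_sup (f := f) ha))
        ((inf_le_inf inf_le_right inf_le_right).trans (Finset.le_sup (f := f) hb))
    have hsub : S (P.sup f) ∩ S (Q.sup f) ⊆ S (R.sup f) := by
      rw [hSf hP, hSf hQ, hSf hR]
      rintro t ⟨ht, ht'⟩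
      simp only [Set.mem_iUnion] at ht ht' ⊢
      obtain ⟨a, ha, ha1, ha2⟩ := ht
      obtain ⟨b, hb, hb1, hb2⟩ := ht'
      have hmeet : S a.1 ∩ S b.1 ⊆ S (a.1 ⊓ b.1) := by
        rcases hc'.total (hP a ha).1 (hQ b hb).1 with h | h
        · rw [inf_eq_left.2 h]; exact Set.inter_subset_left
        · rw [inf_eq_right.2 h]; exact Set.inter_subset_right
      exact ⟨(a.1 ⊓ b.1, a.2 ⊓ b.2),
        Finset.mem_image.2 ⟨(a, b), Finset.mem_product.2 ⟨ha, hb⟩, rfl⟩, hmeet ⟨ha1, hb1⟩,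
        hinf _ _ (hQ b hb).2 ⟨ha2, hb2⟩⟩
    have hsub' : S (P.sup f ⊓ Q.sup f) ⊆ S (P.sup f) ∩ S (Q.sup f) :=
      Set.subset_inter (hmono inf_le_left) (hmono inf_le_right)
    have heq : R.sup f = P.sup f ⊓ Q.sup f :=
      hle.eq_of_not_lt fun hlt => (hS hlt).not_ge (hsub'.trans hsub)
    refine ⟨⟨R, hR, heq.symm⟩, hsub'.antisymm ?_⟩
    rw [← heq]
    exact hsub
  have hgen : latticeClosure (M ∪ c) ⊆ T := by
    refine latticeClosure_min ?_
      ⟨fun x hx y hy => (hTsup x hx y hy).1, fun x hx y hy => (hTinf x hx y hy).1⟩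
    rintro x (hx | hx)
    · exact ⟨{(⊤, x)}, by simpa using hx, by simp [f]⟩
    · exact ⟨{(x, ⊤)}, by simpa using ⟨Or.inr hx, htop⟩, by simp [f]⟩
  rintro ⟨x, hx⟩ ⟨y, hy⟩ ⟨z, hz⟩
  apply Subtype.ext
  change x ⊓ (y ⊔ z) = x ⊓ y ⊔ x ⊓ z
  replace hx := hgen hx
  replace hy := hgen hy
  replace hz := hgen hz
  have hyz := hTsup y hy z hz
  have hxy := hTinf x hx y hy
  have hxz := hTinf x hx z hz
  refine (le_inf_sup.eq_of_not_lt fun hlt => (hS hlt).not_ge ?_).symm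
  rw [(hTinf x hx _ hyz.1).2, hyz.2, (hTsup _ hxy.1 _ hxz.1).2, hxy.2, hxz.2,
    Set.inter_union_distrib_left]

end RankSets

/-! ### Labeled paths in the Hasse diagram -/

section Paths

variable {L : Type*} [PartialOrder L] {lab : Edge L → ℤ}

/-- `Path lab s t vs ls` says that there is a saturated chain from `s` to `t` whose elements
other than `s` are listed, in order, in `vs`, and whose edges carry the labels `ls`. -/
inductive Path (lab : Edge L → ℤ) : L → L → List L → List ℤ → Prop
  | nil (s : L) : Path lab s s [] []
  | cons {s u t : L} {vs : List L} {ls : List ℤ} (h : s ⋖ u) (p : Path lab u t vs ls) :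
      Path lab s t (u :: vs) (lab ⟨(s, u), h⟩ :: ls)

namespace Path

variable {s t u : L} {vs vs' : List L} {ls ls' : List ℤ}

theorem append (p : Path lab s u vs ls) (q : Path lab u t vs' ls') :
    Path lab s t (vs ++ vs') (ls ++ ls') := by
  induction p with
  | nil => exact q
  | cons h _ ih => exact cons h (ih q)

theorem le (p : Path lab s t vs ls) : s ≤ t := by
  induction p with
  | nil => exact le_rfl
  | cons h _ ih => exact h.le.trans ih

theorem le_of_mem (p : Path lab s t vs ls) {z : L} (hz : z ∈ s :: vs) : s ≤ z := by
  induction p with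
  | nil => simp_all
  | cons h _ ih =>
    rcases List.mem_cons.1 hz with rfl | hz
    · exact le_rfl
    · exact h.le.trans (ih hz)

theorem last_mem (p : Path lab s t vs ls) : t ∈ s :: vs := by
  induction p with
  | nil => simp
  | cons h _ ih => exact List.mem_cons_of_mem _ ih

theorem labels_ne_nil (p : Path lab s t vs ls) (h : s ≠ t) : ls ≠ [] := by
  cases p <;> simp_all

theorem exists_split_of_mem (p : Path lab s t vs ls) {z : L} (hz : z ∈ s :: vs) :
    ∃ vs₁ vs₂ ls₁ ls₂, ls = ls₁ ++ ls₂ ∧ Path lab s z vs₁ ls₁ ∧ Path lab z t vs₂ ls₂ := by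
  induction p with
  | nil s =>
    obtain rfl : z = s := by simpa using hz
    exact ⟨[], [], [], [], rfl, nil z, nil z⟩
  | @cons s u t vs ls h p ih =>
    rcases List.mem_cons.1 hz with rfl | hz
    · exact ⟨[], _, [], _, rfl, nil z, cons h p⟩
    · obtain ⟨vs₁, vs₂, ls₁, ls₂, rfl, p₁, p₂⟩ := ih hz
      exact ⟨_, _, _, _, rfl, cons h p₁, p₂⟩

/-- A path with increasing labels can be cut between the labels in a set `D` and those outside,
provided that `D` contains every label of the path below one of its members. -/
theorem exists_split_of_sorted (p : Path lab s t vs ls) (hs : ls.Pairwise (· ≤ ·)) {D : Set ℤ}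
    (hD : ∀ a ∈ ls, ∀ b ∈ D, a ≤ b → a ∈ D) :
    ∃ u vs₁ vs₂ ls₁ ls₂, ls = ls₁ ++ ls₂ ∧ Path lab s u vs₁ ls₁ ∧
      Path lab u t vs₂ ls₂ ∧ (∀ a ∈ ls₁, a ∈ D) ∧ ∀ a ∈ ls₂, a ∉ D := by
  induction p with
  | nil s => exact ⟨s, [], [], [], [], rfl, nil s, nil s, by simp, by simp⟩
  | @cons s u t vs ls h p ih =>
    rw [List.pairwise_cons] at hs
    by_cases ha : lab ⟨(s, u), h⟩ ∈ D
    · obtain ⟨v, vs₁, vs₂, ls₁, ls₂, rfl, p₁, p₂, h₁, h₂⟩ :=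
        ih hs.2 fun a ha => hD a (List.mem_cons_of_mem _ ha)
      refine ⟨v, _, _, _, _, rfl, cons h p₁, p₂, ?_, h₂⟩
      rintro a (_ | ⟨_, h'⟩)
      exacts [ha, h₁ a h']
    · refine ⟨s, [], _, [], _, rfl, nil s, cons h p, by simp, ?_⟩
      rintro a (_ | ⟨_, h'⟩) hmem
      · exact ha hmem
      · exact ha (hD _ List.mem_cons_self a hmem (hs.1 a h'))

theorem isChain (p : Path lab s t vs ls) : IsChain (· ≤ ·) {z | z ∈ s :: vs} := by
  induction p with
  | nil => simp [IsChain]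
  | @cons s u t vs ls h p ih =>
    have : {z | z ∈ s :: u :: vs} = insert s {z | z ∈ u :: vs} := by ext; simp
    rw [this]
    exact ih.insert fun z hz _ => Or.inl (h.le.trans (p.le_of_mem hz))

/-- An element of `[s, t]` comparable with all elements of a saturated chain from `s` to `t` is one
of them. -/
theorem mem_of_comparable (p : Path lab s t vs ls) {y : L} (hsy : s ≤ y) (hyt : y ≤ t)
    (hy : ∀ z ∈ s :: vs, y ≤ z ∨ z ≤ y) : y ∈ s :: vs := by
  induction p with
  | nil s => simp [le_antisymm hyt hsy]
  | @cons s u t vs ls h p ih =>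
    rcases hy u (by simp) with hu | hu
    · rcases hsy.eq_or_lt with rfl | hlt
      · simp
      · obtain rfl : y = u := hu.eq_of_not_lt fun h' => h.2 hlt h'
        simp
    · exact List.mem_cons_of_mem _ (ih hu hyt fun z hz => hy z (List.mem_cons_of_mem _ hz))

theorem ofFn {k : ℕ} (f : Fin (k + 1) → L) (hf : ∀ i : Fin k, f i.castSucc ⋖ f i.succ) :
    Path lab (f 0) (f (Fin.last k)) (List.ofFn fun i : Fin k => f i.succ)
      (List.ofFn fun i : Fin k => lab ⟨(f i.castSucc, f i.succ), hf i⟩) := by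
  induction k with
  | zero => simpa using nil (lab := lab) (f 0)
  | succ k ih =>
    rw [List.ofFn_succ, List.ofFn_succ]
    exact cons (hf 0) (ih (fun i => f i.succ) fun i => hf i.succ)

end Path

theorem IsMaxChainOf.path {m : SaturatedChain L} {s t : L} (h : IsMaxChainOf m s t) :
    Path lab s t (List.ofFn fun i : Fin m.length => m i.succ) (List.ofFn (labels lab m)) := by
  obtain ⟨rfl, rfl⟩ := h
  exact Path.ofFn m.toFun m.step

theorem Path.exists_saturatedChain {s t : L} {vs : List L} {ls : List ℤ}
    (p : Path lab s t vs ls) : ∃ m : SaturatedChain L, IsMaxChainOf m s t ∧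
      (List.ofFn fun i : Fin m.length => m i.succ) = vs ∧ List.ofFn (labels lab m) = ls := by
  induction p with
  | nil s => exact ⟨⟨0, fun _ => s, fun i => i.elim0⟩, ⟨rfl, rfl⟩, rfl, rfl⟩
  | @cons s u t vs ls h p ih =>
    obtain ⟨⟨k, f, hf⟩, ⟨rfl, rfl⟩, rfl, rfl⟩ := ih
    have hstep : ∀ i : Fin (k + 1),
        (Fin.cons s f : Fin (k + 2) → L) i.castSucc ⋖ (Fin.cons s f : Fin (k + 2) → L) i.succ := by
      intro i
      induction i using Fin.cases with
      | zero => exact h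
      | succ i => exact hf i
    refine ⟨⟨k + 1, Fin.cons s f, hstep⟩, ⟨rfl, rfl⟩, ?_, ?_⟩
    · dsimp only
      rw [List.ofFn_succ]
      rfl
    · dsimp only [labels]
      rw [List.ofFn_succ]
      rfl

theorem IsMaxChainOf.eq_of_ofFn_eq {m m' : SaturatedChain L} {s t : L} (h : IsMaxChainOf m s t)
    (h' : IsMaxChainOf m' s t) (he : (List.ofFn fun i : Fin m.length => m i.succ) =
      List.ofFn fun i : Fin m'.length => m' i.succ) : m = m' := by
  obtain ⟨k, f, hf⟩ := m
  obtain ⟨k', f', hf'⟩ := m'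
  obtain rfl : k = k' := by simpa using congrArg List.length he
  have h0 : f 0 = f' 0 := h.1.trans h'.1.symm
  have h1 := List.ofFn_injective he
  obtain rfl : f = f' := by
    funext i
    induction i using Fin.cases with
    | zero => exact h0
    | succ i => exact congrFun h1 i
  rfl

theorem isIncreasing_iff {m : SaturatedChain L} :
    IsIncreasing lab m ↔ (List.ofFn (labels lab m)).Pairwise (· ≤ ·) := by
  rw [← List.sortedLE_iff_pairwise, List.sortedLE_ofFn_iff]
  rfl

theorem isELLabeling_iff_path : IsELLabeling lab ↔ ∀ s t : L, s ≤ t → ∃ vs ls,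
    Path lab s t vs ls ∧ ls.Pairwise (· ≤ ·) ∧ ∀ vs' ls', Path lab s t vs' ls' →
      (ls'.Pairwise (· ≤ ·) → vs' = vs) ∧ (vs' ≠ vs → ls < ls') := by
  refine forall_congr' fun s => forall_congr' fun t => imp_congr_right fun _ => ⟨?_, ?_⟩
  · rintro ⟨m, hm, hinc, huniq, hlex⟩
    refine ⟨_, _, hm.path, isIncreasing_iff.1 hinc, fun vs' ls' p => ?_⟩
    obtain ⟨m', hm', rfl, rfl⟩ := p.exists_saturatedChain
    refine ⟨fun h => by rw [huniq m' hm' (isIncreasing_iff.2 h)], fun h => hlex m' hm' ?_⟩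
    rintro rfl
    exact h rfl
  · rintro ⟨vs, ls, p, hinc, hall⟩
    obtain ⟨m, hm, rfl, rfl⟩ := p.exists_saturatedChain
    exact ⟨m, hm, isIncreasing_iff.2 hinc,
      fun m' hm' h' => hm'.eq_of_ofFn_eq hm ((hall _ _ hm'.path).1 (isIncreasing_iff.1 h')),
      fun m' hm' hne => (hall _ _ hm'.path).2 fun he => hne (hm'.eq_of_ofFn_eq hm he)⟩

theorem bijOn_univ_iff_ofFn {k : ℕ} {f : Fin k → ℤ} {A : Set ℤ} :
    Set.BijOn f Set.univ A ↔ (List.ofFn f).Nodup ∧ ∀ a, a ∈ List.ofFn f ↔ a ∈ A := by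
  rw [List.nodup_ofFn]
  constructor
  · intro h
    refine ⟨Set.injOn_univ.1 h.injOn, fun a => ?_⟩
    rw [List.mem_ofFn', ← Set.image_univ, h.image_eq]
  · rintro ⟨hi, hA⟩
    refine ⟨fun i _ => (hA _).1 (by simp), hi.injOn, fun a ha => ?_⟩
    obtain ⟨i, rfl⟩ := (List.mem_ofFn' f a).1 ((hA a).2 ha)
    exact ⟨i, trivial, rfl⟩

theorem isSnELLabeling_iff_path [BoundedOrder L] {n : ℕ} : IsSnELLabeling n lab ↔
    (∀ s t : L, s ≤ t → ∃ vs ls, Path lab s t vs ls ∧ ls.Pairwise (· ≤ ·) ∧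
      ∀ vs' ls', Path lab s t vs' ls' →
        (ls'.Pairwise (· ≤ ·) → vs' = vs) ∧ (vs' ≠ vs → ls < ls')) ∧
    ∀ vs ls, Path lab (⊥ : L) ⊤ vs ls → ls.Nodup ∧ ∀ a, a ∈ ls ↔ a ∈ Set.Icc (1 : ℤ) n := by
  refine and_congr isELLabeling_iff_path ⟨fun h vs ls p => ?_, fun h m hm => ?_⟩
  · obtain ⟨m, hm, rfl, rfl⟩ := p.exists_saturatedChain
    exact bijOn_univ_iff_ofFn.1 (h m hm)
  · exact bijOn_univ_iff_ofFn.2 (h _ _ hm.path)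

end Paths

/-! ### From a labeling to an M-chain -/

section LabelSet

variable {L : Type*} [PartialOrder L] [BoundedOrder L] {lab : Edge L → ℤ} {n : ℕ}

/-- The set of all labels on saturated chains from `⊥` to `x`. -/
def labelSet (lab : Edge L → ℤ) (x : L) : Set ℤ :=
  {a | ∃ vs ls, Path lab ⊥ x vs ls ∧ a ∈ ls}

/-- The labels on one chain from `⊥` to `x` determine `labelSet lab x`: on every such chain they are
the complement in `{1, …, n}` of the labels of any fixed chain from `x` to `⊤`. -/
theorem mem_labelSet_iff (hex : ∀ s t : L, s ≤ t → ∃ vs ls, Path lab s t vs ls)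
    (hperm : ∀ vs ls, Path lab (⊥ : L) ⊤ vs ls → ls.Nodup ∧ ∀ a, a ∈ ls ↔ a ∈ Set.Icc (1 : ℤ) n)
    {x : L} {vs : List L} {ls : List ℤ} (p : Path lab ⊥ x vs ls) (a : ℤ) :
    a ∈ labelSet lab x ↔ a ∈ ls := by
  refine ⟨?_, fun h => ⟨vs, ls, p, h⟩⟩
  rintro ⟨vs', ls', p', ha⟩
  obtain ⟨ws, ks, q⟩ := hex x ⊤ le_top
  have h1 := hperm _ _ (p.append q)
  have h2 := hperm _ _ (p'.append q)
  have h3 := (h1.2 a).2 ((h2.2 a).1 (List.mem_append_left _ ha))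
  exact (List.mem_append.1 h3).resolve_right (List.disjoint_of_nodup_append h2.1 ha)

theorem labelSet_subset_Icc (hex : ∀ s t : L, s ≤ t → ∃ vs ls, Path lab s t vs ls)
    (hperm : ∀ vs ls, Path lab (⊥ : L) ⊤ vs ls → ls.Nodup ∧ ∀ a, a ∈ ls ↔ a ∈ Set.Icc (1 : ℤ) n)
    (x : L) : labelSet lab x ⊆ Set.Icc (1 : ℤ) n := by
  rintro a ⟨vs, ls, p, ha⟩
  obtain ⟨ws, ks, q⟩ := hex x ⊤ le_top
  exact ((hperm _ _ (p.append q)).2 a).1 (List.mem_append_left _ ha)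

theorem labelSet_append (hex : ∀ s t : L, s ≤ t → ∃ vs ls, Path lab s t vs ls)
    (hperm : ∀ vs ls, Path lab (⊥ : L) ⊤ vs ls → ls.Nodup ∧ ∀ a, a ∈ ls ↔ a ∈ Set.Icc (1 : ℤ) n)
    {x y : L} {vs : List L} {ls : List ℤ} (p : Path lab x y vs ls) (a : ℤ) :
    (a ∈ labelSet lab y ↔ a ∈ labelSet lab x ∨ a ∈ ls) ∧ (a ∈ ls → a ∉ labelSet lab x) := by
  obtain ⟨ws, ks, q⟩ := hex ⊥ x bot_le
  obtain ⟨ws', ks', q'⟩ := hex y ⊤ le_top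
  have hnd := (hperm _ _ ((q.append p).append q')).1
  rw [mem_labelSet_iff hex hperm q, mem_labelSet_iff hex hperm (q.append p), List.mem_append]
  exact ⟨Iff.rfl, fun h h' => List.disjoint_of_nodup_append (List.Nodup.of_append_left hnd) h' h⟩

theorem labelSet_bot (hex : ∀ s t : L, s ≤ t → ∃ vs ls, Path lab s t vs ls)
    (hperm : ∀ vs ls, Path lab (⊥ : L) ⊤ vs ls → ls.Nodup ∧ ∀ a, a ∈ ls ↔ a ∈ Set.Icc (1 : ℤ) n) :
    labelSet lab (⊥ : L) = ∅ := by
  ext a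
  simp [mem_labelSet_iff hex hperm (Path.nil ⊥)]

theorem labelSet_strictMono (hex : ∀ s t : L, s ≤ t → ∃ vs ls, Path lab s t vs ls)
    (hperm : ∀ vs ls, Path lab (⊥ : L) ⊤ vs ls → ls.Nodup ∧ ∀ a, a ∈ ls ↔ a ∈ Set.Icc (1 : ℤ) n) :
    StrictMono (labelSet lab : L → Set ℤ) := by
  intro x y hxy
  obtain ⟨vs, ls, p⟩ := hex x y hxy.le
  obtain ⟨a, ha⟩ := List.exists_mem_of_ne_nil _ (p.labels_ne_nil hxy.ne)
  refine ⟨fun b hb => ((labelSet_append hex hperm p b).1).2 (Or.inl hb), fun h => ?_⟩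
  have := labelSet_append hex hperm p a
  exact this.2 ha (h (this.1.2 (Or.inr ha)))

end LabelSet

section MChain

variable {L : Type*} [Lattice L] [BoundedOrder L] {lab : Edge L → ℤ} {n : ℕ}

/-- The increasing chain from `⊥` to `⊤` is an M-chain. Its elements are the `z` whose label set is an
initial segment of `{1, …, n}`, as joining increasing chains of `[⊥, z]` and `[z, ⊤]` shows. Cutting
an increasing chain of `[⊥, x]` at the labels of such an `m` gives an element which is seen to be
`x ⊓ m`, with label set the intersection; joins `x ⊔ m` are dual. -/
theorem isSupersolvable_of_isSnELLabeling (h : IsSnELLabeling n lab) : IsSupersolvable L := by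
  obtain ⟨hEL, hperm⟩ := isSnELLabeling_iff_path.1 h
  have hinc : ∀ s t : L, s ≤ t → ∃ vs ls, Path lab s t vs ls ∧ ls.Pairwise (· ≤ ·) := by
    intro s t hst
    obtain ⟨vs, ls, p, hs, -⟩ := hEL s t hst
    exact ⟨vs, ls, p, hs⟩
  have hex : ∀ s t : L, s ≤ t → ∃ vs ls, Path lab s t vs ls := by
    intro s t hst
    obtain ⟨vs, ls, p, -⟩ := hinc s t hst
    exact ⟨vs, ls, p⟩
  have happ := @labelSet_append L _ _ lab n hex hperm
  have hS := labelSet_strictMono hex hperm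
  obtain ⟨vM, lM, pM, hsM, hM⟩ := hEL ⊥ ⊤ bot_le
  set M : Set L := {z | z ∈ ⊥ :: vM}
  set S : L → Set ℤ := labelSet lab
  have hIcc : ∀ x, S x ⊆ Set.Icc (1 : ℤ) n := labelSet_subset_Icc hex hperm
  have hchain : IsChain (· ≤ ·) M := pM.isChain
  have hmax : IsMaxChain (· ≤ ·) M := by
    refine ⟨hchain, fun t ht hMt => hMt.antisymm fun y hy => ?_⟩
    exact pM.mem_of_comparable bot_le le_top fun z hz => ht.total hy (hMt hz)
  have hmemIcc : ∀ {x vs ls}, Path lab x ⊤ vs ls → ∀ a, a ∈ ls ↔ a ∈ Set.Icc (1 : ℤ) n ∧ a ∉ S x := by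
    intro x vs ls p a
    obtain ⟨ws, ks, q⟩ := hex ⊥ x bot_le
    have h1 := (hperm _ _ (q.append p)).2 a
    rw [List.mem_append, ← mem_labelSet_iff hex hperm q] at h1
    have h2 := (happ p a).2
    tauto
  have hlow : ∀ m ∈ M, ∀ b ∈ S m, ∀ a ∈ Set.Icc (1 : ℤ) n, a ≤ b → a ∈ S m := by
    intro m hm b hb a ha hab
    by_contra hna
    obtain ⟨_, _, ls₁, ls₂, rfl, p₁, p₂⟩ := pM.exists_split_of_mem hm
    have ha2 := (hmemIcc p₂ a).2 ⟨ha, hna⟩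
    have hb1 := (mem_labelSet_iff hex hperm p₁ b).1 hb
    have := (List.pairwise_append.1 hsM).2.2 b hb1 a ha2
    obtain rfl := le_antisymm hab this
    exact hna hb
  -- an increasing chain of `[⊥, z]` followed by one of `[z, ⊤]` is increasing, hence equal to `M`
  have hmemM : ∀ z, (∀ b ∈ S z, ∀ a ∈ Set.Icc (1 : ℤ) n, a ≤ b → a ∈ S z) → z ∈ M := by
    intro z hz
    obtain ⟨vs, ls, p, hp⟩ := hinc ⊥ z bot_le
    obtain ⟨ws, ks, q, hq⟩ := hinc z ⊤ le_top
    have := (hM _ _ (p.append q)).1 <| List.pairwise_append.2 ⟨hp, hq, fun b hb a ha => by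
      rw [← mem_labelSet_iff hex hperm p] at hb
      rw [hmemIcc q] at ha
      exact le_of_not_ge fun hab => ha.2 (hz b hb a ha.1 hab)⟩
    have hz' := p.last_mem
    change z ∈ ⊥ :: vM
    rw [← this]
    rcases List.mem_cons.1 hz' with rfl | hz'
    · simp
    · simp [hz']
  have hMeq : ∀ m ∈ M, ∀ z, S z = S m → z = m := by
    intro m hm z hz
    have hzM : z ∈ M := hmemM z (hz ▸ hlow m hm)
    rcases hchain.total hzM hm with h' | h'
    · exact h'.eq_of_not_lt fun hlt => (hS hlt).ne hz
    · exact (h'.eq_of_not_lt fun hlt => (hS hlt).ne hz.symm).symm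
  -- cutting an increasing chain of `[x, y]` at the labels of `m`
  have hcut : ∀ x y, x ≤ y → ∀ m ∈ M, ∃ z, x ≤ z ∧ z ≤ y ∧ S z = S x ∪ (S y ∩ S m) := by
    intro x y hxy m hm
    obtain ⟨vs, ls, p, hp⟩ := hinc x y hxy
    obtain ⟨z, vs₁, vs₂, ls₁, ls₂, rfl, p₁, p₂, h₁, h₂⟩ := p.exists_split_of_sorted (D := S m) hp
      fun a ha b hb hab => hlow m hm b hb a (hIcc y ((happ p a).1.2 (Or.inr ha))) hab
    refine ⟨z, p₁.le, p₂.le, ?_⟩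
    ext a
    have e1 := (happ p₁ a).1
    have e2 := (happ p₂ a).1
    have := h₁ a
    have := h₂ a
    simp only [Set.mem_union, Set.mem_inter_iff]
    change a ∈ S y ↔ _ at e2
    change a ∈ S z ↔ _ at e1
    change _ ↔ a ∈ S z ∨ _ at e2
    tauto
  have htop : S ⊤ = Set.Icc (1 : ℤ) n := by
    ext a
    exact (mem_labelSet_iff hex hperm pM a).trans ((hperm _ _ pM).2 a)
  have hbot : S ⊥ = ∅ := labelSet_bot hex hperm
  refine ⟨M, hmax, fun c hc => isDistributive_generated_of_rankSet (S := S) hS hbot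
    hchain hmax.top_mem ?_ ?_ hc⟩
  · intro x m hm
    obtain ⟨y, -, hyx, hy⟩ := hcut ⊥ x bot_le m hm
    rw [hbot, Set.empty_union] at hy
    -- `y` extends to an element with the same label set as `m`, hence to `m`
    obtain ⟨z, hyz, -, hz⟩ := hcut y ⊤ le_top m hm
    have hzm : z = m := by
      refine hMeq m hm z (hz.trans ?_)
      rw [hy, htop, Set.inter_eq_right.2 (hIcc m), Set.union_eq_right.2 Set.inter_subset_right]
    rw [← hy]
    exact hS.monotone (le_inf hyx (hzm ▸ hyz))
  · intro x m hm
    obtain ⟨y, hxy, -, hy⟩ := hcut x ⊤ le_top m hm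
    rw [htop, Set.inter_eq_right.2 (hIcc m)] at hy
    obtain ⟨z, -, hzy, hz⟩ := hcut ⊥ y bot_le m hm
    have hzm : z = m := by
      refine hMeq m hm z (hz.trans ?_)
      rw [hbot, hy, Set.empty_union, Set.inter_eq_right.2 Set.subset_union_right]
    rw [← hy]
    exact hS.monotone (sup_le hxy (hzm ▸ hzy))

end MChain

/-! ### From an M-chain to a labeling -/

section Labeling

/-- A labeling is an `S_n` EL-labeling if the label of `x ⋖ y` is the one element by which a set `S y`
exceeds `S x`, and the least element of `S t \ S s` labels exactly one edge from `s` into `[s, t]`: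
then the increasing chain of `[s, t]` is built by always following the least missing label. -/
theorem isSnELLabeling_of_step {L : Type*} [PartialOrder L] [BoundedOrder L] [WellFoundedGT L]
    {lab : Edge L → ℤ} {n : ℕ} {S : L → Set ℤ}
    (hstep : ∀ x y (h : x ⋖ y), S y = insert (lab ⟨(x, y), h⟩) (S x) ∧ lab ⟨(x, y), h⟩ ∉ S x)
    (hbot : S ⊥ = ∅) (htop : S ⊤ = Set.Icc (1 : ℤ) n)
    (hfirst : ∀ s t, s < t → ∃ y, ∃ h : s ⋖ y, y ≤ t ∧
      (∀ a ∈ S t, a ∉ S s → lab ⟨(s, y), h⟩ ≤ a) ∧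
      ∀ y' (h' : s ⋖ y'), y' ≤ t → lab ⟨(s, y'), h'⟩ = lab ⟨(s, y), h⟩ → y' = y) :
    IsSnELLabeling n lab := by
  have hpath : ∀ {s t vs ls}, Path lab s t vs ls →
      S s ⊆ S t ∧ ls.Nodup ∧ ∀ a, a ∈ ls ↔ a ∈ S t ∧ a ∉ S s := by
    intro s t vs ls p
    induction p with
    | nil s => simp
    | @cons s u t vs ls h p ih =>
      obtain ⟨h1, h2⟩ := hstep s u h
      obtain ⟨hsub, hnd, hmem⟩ := ih
      have hsu : S s ⊆ S u := h1 ▸ Set.subset_insert _ _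
      have hl : lab ⟨(s, u), h⟩ ∈ S u := h1 ▸ Set.mem_insert _ _
      refine ⟨hsu.trans hsub, List.nodup_cons.2 ⟨fun h' => ((hmem _).1 h').2 hl, hnd⟩, fun a => ?_⟩
      have h3 : a ∈ S u ↔ a = lab ⟨(s, u), h⟩ ∨ a ∈ S s := by rw [h1]; rfl
      rw [List.mem_cons, hmem]
      constructor
      · rintro (rfl | ⟨ha, ha'⟩)
        · exact ⟨hsub hl, h2⟩
        · exact ⟨ha, fun h' => ha' (hsu h')⟩
      · rintro ⟨ha, ha'⟩
        by_cases e : a = lab ⟨(s, u), h⟩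
        · exact Or.inl e
        · exact Or.inr ⟨ha, fun h' => (h3.1 h').elim e ha'⟩
  rw [isSnELLabeling_iff_path]
  refine ⟨fun s t => ?_, fun vs ls p => ⟨(hpath p).2.1, fun a => ?_⟩⟩
  · induction s using WellFoundedGT.induction with
    | ind s ih =>
    intro hst
    rcases hst.eq_or_lt with rfl | hlt
    · refine ⟨[], [], Path.nil s, List.Pairwise.nil, fun vs' ls' p => ?_⟩
      cases p with
      | nil => simp
      | cons h p => exact absurd p.le h.lt.not_ge
    · obtain ⟨y, hy, hyt, hmin, huniq⟩ := hfirst s t hlt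
      obtain ⟨vs, ls, p, hs, hall⟩ := ih y hy.lt hyt
      have hp := (hpath (p.cons hy)).2.2
      refine ⟨_, _, p.cons hy, List.pairwise_cons.2 ⟨fun a ha => ?_, hs⟩, fun vs' ls' p' => ?_⟩
      · have := (hp a).1 (List.mem_cons_of_mem _ ha)
        exact hmin a this.1 this.2
      · have hp' := (hpath p').2.2
        cases p' with
        | nil => exact absurd hlt (lt_irrefl _)
        | @cons _ u _ vs' ls' h q =>
          have hle : lab ⟨(s, y), hy⟩ ≤ lab ⟨(s, u), h⟩ := by
            have := (hp' _).1 List.mem_cons_self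
            exact hmin _ this.1 this.2
          constructor
          · intro hs'
            have hmem := (hp' _).2 ((hp (lab ⟨(s, y), hy⟩)).1 List.mem_cons_self)
            have hle' : lab ⟨(s, u), h⟩ ≤ lab ⟨(s, y), hy⟩ := by
              rcases List.mem_cons.1 hmem with e | hmem
              · exact e.ge
              · exact (List.pairwise_cons.1 hs').1 _ hmem
            obtain rfl := huniq u h q.le (le_antisymm hle' hle)
            rw [(hall _ _ q).1 (List.pairwise_cons.1 hs').2]
          · intro hne
            rw [List.cons_lt_cons_iff]
            rcases hle.lt_or_eq with hlt' | heq
            · exact Or.inl hlt'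
            · obtain rfl := huniq u h q.le heq.symm
              exact Or.inr ⟨rfl, (hall _ _ q).2 fun e => hne (by rw [e])⟩
  · rw [(hpath p).2.2, htop, hbot]
    simp

/-- A maximal chain with `n + 1` elements, listed in increasing order. -/
theorem exists_enumeration_of_isMaxChain {L : Type*} [PartialOrder L] [BoundedOrder L] {M : Set L}
    (hM : IsMaxChain (· ≤ ·) M) {n : ℕ} (hn : M.ncard = n + 1) :
    ∃ m : ℕ → L, m 0 = ⊥ ∧ m n = ⊤ ∧ Monotone m ∧ (∀ i < n, m i ⋖ m (i + 1)) ∧ ∀ i, m i ∈ M := by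
  classical
  have hfin : M.Finite := Set.finite_of_ncard_ne_zero (by omega)
  let F : Flag L := Flag.ofIsMaxChain M hM
  have : Fintype F := hfin.fintype
  have hcard : Fintype.card F = n + 1 := by
    rw [← hn, ← Nat.card_eq_fintype_card]; rfl
  let e : Fin (n + 1) ≃o F := Fintype.orderIsoFinOfCardEq F hcard
  refine ⟨fun i => e ⟨min i n, by omega⟩, ?_, ?_, ?_, ?_, fun i => (e _).2⟩
  · have : (⟨min 0 n, by omega⟩ : Fin (n + 1)) = ⊥ := Fin.ext (by simp [bot_eq_zero])
    simp only [this, map_bot]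
    rfl
  · have : (⟨min n n, by omega⟩ : Fin (n + 1)) = ⊤ := Fin.ext (by simp [Fin.top_eq_last])
    simp only [this, map_top]
    rfl
  · intro i j hij
    exact e.monotone (Fin.mk_le_mk.2 (min_le_min_right n hij))
  · intro i hi
    refine Flag.coe_covBy_coe.2 ((apply_covBy_apply_iff e).2 ?_)
    rw [Fin.covBy_iff, Nat.covBy_iff_add_one_eq]
    simp only
    omega

/-- An M-chain `m 0 ⋖ m 1 ⋖ ⋯ ⋖ m n` yields Stanley's labeling: the label of `x ⋖ y` is the least `i`
with `y ≤ x ⊔ m i`. Distributivity makes it the only `i` with `m i ≤ y ⊔ m (i - 1)` and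
`¬ m i ≤ x ⊔ m (i - 1)`. -/
theorem isSnELShellable_of_isMChain {L : Type*} [Lattice L] [BoundedOrder L] [Finite L] {n : ℕ}
    {M : Set L} (hM : IsMChain M) (hn : M.ncard = n + 1) : IsSnELShellable L n := by
  classical
  obtain ⟨m, m0, mn, hmono, hcov, hmM⟩ := exists_enumeration_of_isMaxChain hM.1 hn
  have hdist : ∀ x y, x ≤ y → ∀ a b c, a ∈ M ∪ {x, y} → b ∈ M ∪ {x, y} → c ∈ M ∪ {x, y} →
      a ⊓ (b ⊔ c) = a ⊓ b ⊔ a ⊓ c := by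
    intro x y hxy a b c ha hb hc
    have hch : IsChain (· ≤ ·) ({x, y} : Set L) := IsChain.pair hxy
    exact congrArg Subtype.val (hM.2 _ hch ⟨a, subset_latticeClosure ha⟩
      ⟨b, subset_latticeClosure hb⟩ ⟨c, subset_latticeClosure hc⟩)
  -- the two instances of distributivity that are used
  have hA : ∀ y i, m (i + 1) ≤ y ⊔ m i → m (i + 1) ≤ m (i + 1) ⊓ y ⊔ m i := by
    intro y i h
    calc m (i + 1) = m (i + 1) ⊓ (y ⊔ m i) := (inf_eq_left.2 h).symm
      _ = _ := hdist y y le_rfl _ _ _ (Or.inl (hmM _)) (by simp) (Or.inl (hmM _))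
      _ ≤ _ := sup_le_sup_left inf_le_right _
  have hB : ∀ x y j, x ≤ y → y ≤ x ⊔ m j → y ≤ x ⊔ y ⊓ m j := by
    intro x y j hxy h
    calc y = y ⊓ (x ⊔ m j) := (inf_eq_left.2 h).symm
      _ = _ := hdist x y hxy _ _ _ (by simp) (by simp) (Or.inl (hmM _))
      _ ≤ _ := sup_le_sup_right inf_le_right _
  have hinf : ∀ {a b c : L}, a ⋖ b → a ≤ c → ¬ b ≤ c → c ⊓ b ≤ a := by
    intro a b c hab hac hbc
    by_contra hne
    have h1 : a < c ⊓ b := lt_of_le_not_ge (le_inf hac hab.le) hne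
    exact hbc (((inf_le_right.eq_of_not_lt fun h2 => hab.2 h1 h2).ge).trans inf_le_left)
  -- the prime intervals `[x, y]` and `[m i, m (i + 1)]` are projective from either side
  have hjump : ∀ {x y i}, x ⋖ y → i < n → (y ≤ x ⊔ m (i + 1) ∧ ¬ y ≤ x ⊔ m i ↔
      m (i + 1) ≤ y ⊔ m i ∧ ¬ m (i + 1) ≤ x ⊔ m i) := by
    intro x y i hxy hi
    constructor
    · rintro ⟨h1, h2⟩
      refine ⟨?_, fun h => h2 (h1.trans (sup_le le_sup_left h))⟩
      by_contra h
      have h3 := hinf (hcov i hi) le_sup_right h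
      refine h2 ((hB x y _ hxy.le h1).trans (sup_le_sup_left ?_ _))
      exact (inf_le_inf_right _ le_sup_left).trans h3
    · rintro ⟨h1, h2⟩
      refine ⟨?_, fun h => h2 (h1.trans (sup_le h le_sup_right))⟩
      by_contra h
      have h3 := hinf hxy le_sup_left h
      refine h2 ((hA y i h1).trans (sup_le_sup_right ?_ _))
      exact (le_inf (inf_le_left.trans le_sup_right) inf_le_right).trans h3
  have hex : ∀ e : Edge L, ∃ i, i < n ∧ e.1.2 ≤ e.1.1 ⊔ m (i + 1) ∧ ¬ e.1.2 ≤ e.1.1 ⊔ m i := by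
    rintro ⟨⟨x, y⟩, h : x ⋖ y⟩
    have hP : ∃ i, y ≤ x ⊔ m i := ⟨n, by simp [mn]⟩
    obtain ⟨k, hk⟩ : ∃ k, Nat.find hP = k + 1 := by
      refine Nat.exists_eq_succ_of_ne_zero fun h0 => h.lt.not_ge ?_
      have := Nat.find_spec hP
      rwa [h0, m0, sup_bot_eq] at this
    have hkn : k + 1 ≤ n := hk ▸ Nat.find_min' hP (by simp [mn])
    exact ⟨k, by omega, hk ▸ Nat.find_spec hP, Nat.find_min hP (by omega)⟩
  choose f hfn hf1 hf2 using hex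
  have hfu : ∀ {x y} (h : x ⋖ y) {i}, i < n → m (i + 1) ≤ y ⊔ m i → ¬ m (i + 1) ≤ x ⊔ m i →
      i = f ⟨(x, y), h⟩ := by
    intro x y h i hi h1 h2
    obtain ⟨h3, h4⟩ := (hjump h hi).2 ⟨h1, h2⟩
    have h5 : y ≤ x ⊔ m (f ⟨(x, y), h⟩ + 1) := hf1 ⟨(x, y), h⟩
    have h6 : ¬ y ≤ x ⊔ m (f ⟨(x, y), h⟩) := hf2 ⟨(x, y), h⟩
    rcases lt_trichotomy i (f ⟨(x, y), h⟩) with hlt | heq | hlt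
    · exact absurd (h3.trans (sup_le_sup_left (hmono hlt) _)) h6
    · exact heq
    · exact absurd (h5.trans (sup_le_sup_left (hmono hlt) _)) h4
  have hff : ∀ {x y} (h : x ⋖ y), m (f ⟨(x, y), h⟩ + 1) ≤ y ⊔ m (f ⟨(x, y), h⟩) ∧
      ¬ m (f ⟨(x, y), h⟩ + 1) ≤ x ⊔ m (f ⟨(x, y), h⟩) :=
    fun {x y} h => (hjump h (hfn _)).1 ⟨hf1 ⟨(x, y), h⟩, hf2 ⟨(x, y), h⟩⟩
  -- indices start at `0` and labels at `1`: the step `m i ⋖ m (i + 1)` carries the label `i + 1`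
  set S : L → Set ℤ := fun x => {a | ∃ i : ℕ, i < n ∧ m (i + 1) ≤ x ⊔ m i ∧ a = i + 1}
  refine ⟨fun e => (f e : ℤ) + 1, isSnELLabeling_of_step (S := S) ?_ ?_ ?_ ?_⟩
  · intro x y h
    refine ⟨Set.Subset.antisymm ?_ (Set.insert_subset ⟨_, hfn _, (hff h).1, rfl⟩ ?_), ?_⟩
    · rintro _ ⟨i, hi, h1, rfl⟩
      by_cases h2 : m (i + 1) ≤ x ⊔ m i
      · exact Or.inr ⟨i, hi, h2, rfl⟩
      · left
        rw [hfu h hi h1 h2]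
    · rintro _ ⟨i, hi, h1, rfl⟩
      exact ⟨i, hi, h1.trans (sup_le_sup_right h.le _), rfl⟩
    · rintro ⟨i, hi, h1, h2⟩
      obtain rfl : f ⟨(x, y), h⟩ = i := by omega
      exact (hff h).2 h1
  · refine Set.eq_empty_of_forall_notMem ?_
    rintro _ ⟨i, hi, h1, rfl⟩
    rw [bot_sup_eq] at h1
    exact (hcov i hi).lt.not_ge h1
  · ext a
    constructor
    · rintro ⟨i, hi, -, rfl⟩
      exact ⟨by omega, by omega⟩
    · rintro ⟨h1, h2⟩
      exact ⟨(a - 1).toNat, by omega, by simp, by omega⟩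
  · intro s t hst
    have hcovex : ∀ {x z : L}, x < z → ∃ y, x ⋖ y ∧ y ≤ z := fun {x z} h =>
      exists_covBy_le_of_lt h
    have hP : ∃ i, i < n ∧ m (i + 1) ≤ t ⊔ m i ∧ ¬ m (i + 1) ≤ s ⊔ m i := by
      obtain ⟨y, hy, hyt⟩ := hcovex hst
      exact ⟨_, hfn _, (hff hy).1.trans (sup_le_sup_right hyt _), (hff hy).2⟩
    obtain ⟨i, ⟨hi, hi1, hi2⟩, himin⟩ : ∃ i, (i < n ∧ m (i + 1) ≤ t ⊔ m i ∧ ¬ m (i + 1) ≤ s ⊔ m i) ∧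
        ∀ k, (k < n ∧ m (k + 1) ≤ t ⊔ m k ∧ ¬ m (k + 1) ≤ s ⊔ m k) → i ≤ k :=
      ⟨Nat.find hP, Nat.find_spec hP, fun k hk => Nat.find_min' hP hk⟩
    -- the wanted cover of `s` is `s ⊔ m (i + 1) ⊓ t`
    set y₀ := s ⊔ m (i + 1) ⊓ t
    have hy₀t : y₀ ≤ t := sup_le hst.le inf_le_right
    -- every edge of `[s, y₀]` carries the least missing label, so `s ⋖ y₀`
    have hlab : ∀ {x y} (h : x ⋖ y), s ≤ x → y ≤ y₀ → f ⟨(x, y), h⟩ = i := by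
      intro x y h hsx hyy
      obtain ⟨h1, h2⟩ := hff h
      set k := f ⟨(x, y), h⟩
      have h3 : ¬ m (k + 1) ≤ s ⊔ m k := fun h' => h2 (h'.trans (sup_le_sup_right hsx _))
      refine le_antisymm ?_ (himin k ⟨hfn _, h1.trans (sup_le_sup_right (hyy.trans hy₀t) _), h3⟩)
      by_contra hlt
      refine h3 (h1.trans (sup_le (hyy.trans (sup_le_sup_left ?_ _)) le_sup_right))
      exact inf_le_left.trans (hmono (by omega))
    have heq : ∀ {y}, s ⋖ y → y ≤ y₀ → y = y₀ := by
      intro y h hy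
      by_contra hne
      obtain ⟨w, hw, hwy⟩ := hcovex (lt_of_le_of_ne hy hne)
      have h1 := (hff h).1
      have h2 := (hff hw).2
      rw [hlab h le_rfl hy] at h1
      rw [hlab hw h.le hwy] at h2
      exact h2 h1
    have hlt : s < y₀ := by
      refine le_sup_left.lt_of_ne fun he => hi2 ?_
      exact (hA t i hi1).trans (sup_le_sup_right (le_sup_right.trans he.ge) _)
    obtain ⟨y, hy, hyy⟩ := hcovex hlt
    refine ⟨y, hy, hyy.trans hy₀t, ?_, ?_⟩
    · rintro _ ⟨k, hk, h1, rfl⟩ hk'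
      have := himin k ⟨hk, h1, fun h2 => hk' ⟨k, hk, h2, rfl⟩⟩
      rw [hlab hy le_rfl hyy]
      omega
    · intro y' h' hy't he
      have he' : f ⟨(s, y'), h'⟩ = i := by
        rw [hlab hy le_rfl hyy] at he
        omega
      have h1 : y' ≤ s ⊔ m (f ⟨(s, y'), h'⟩ + 1) := hf1 ⟨(s, y'), h'⟩
      rw [he'] at h1
      have h2 : y' ≤ y₀ := (hB s y' _ h'.le h1).trans
        (sup_le_sup_left (le_inf inf_le_right (inf_le_left.trans hy't)) _)
      rw [heq h' h2, heq hy hyy]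

end Labeling
end Snelling

theorem mainTheorem1 (L : Type*) [Lattice L] [BoundedOrder L] [Finite L] (n : ℕ)
    (hL : Snelling.IsGradedOfRank L n) :
    Snelling.IsSupersolvable L ↔ Snelling.IsSnELShellable L n := by
  constructor
  · rintro ⟨M, hM⟩
    exact Snelling.isSnELShellable_of_isMChain hM (hL M hM.1)
  · rintro ⟨lab, hlab⟩
    exact Snelling.isSupersolvable_of_isSnELLabeling hlab
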